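/- Let $\Sigma$ be a finite alphabet. The formulas $\varphi$ and terms $t$ of $\mathsf{LTL}[\mathsf{Count}]$ are given by $$\varphi ::= a \mid t\le t \mid \neg\varphi \mid \varphi\lor\varphi \mid \mathrm{X}\,\varphi \mid \varphi\,\mathrm{U}\,\varphi,\qquad t ::= k \mid k\cdot\overleftarrow{\#\varphi} \mid k\cdot\overrightarrow{\#\varphi} \mid t+t \qquad (a\in\Sigma,\ k\in\mathbb{Z}).$$ For a word $w=a_1\cdots a_\ell\in\Sigma^*$ and a position $1\le i\le \ell$, satisfaction $w,i\models\varphi$ is defined as follows: $w,i\models a$ iff $a_i=a$; the connectives $\neg,\lor$ are Boolean; $w,i\models \mathrm{X}\varphi$ iff $i<\ell$ and $w,i+1\models\varphi$; $w,i\models\varphi\,\mathrm{U}\,\psi$ iff there is $j$ with $i\le j\le\ell$, $w,j\models\psi$ and $w,k\models\varphi$ for all $i\le k<j$; and $w,i\models t_1\le t_2$ iff $[\![t_1]\!](w,i)\le[\![t_2]\!](w,i)$, where $[\![k]\!](w,i)=k$, $[\![t_1+t_2]\!](w,i)=[\![t_1]\!](w,i)+[\![t_2]\!](w,i)$, $[\![k\cdot\overleftarrow{\#\varphi}]\!](w,i)=k\cdot|\{1\le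 j<i : w,j\models\varphi\}|$ and $[\![k\cdot\overrightarrow{\#\varphi}]\!](w,i)=k\cdot|\{i\le j\le\ell : w,j\models\varphi\}|$. A language $L\subseteq\Sigma^*$ is definable in $\mathsf{LTL}[\mathsf{Count}]$ if there is a formula $\varphi$ such that, for every nonempty word $w\in\Sigma^*$, $w\in L$ iff $w,1\models\varphi$ (whether the empty word belongs to $L$ is immaterial). The Parikh map $\Psi\colon\Sigma^*\to\mathbb{N}^\Sigma$ sends $w$ to the vector of the numbers of occurrences $|w|_a$ of the letters $a\in\Sigma$. The language $L$ is permutation-invariant if, for all $u,v\in\Sigma^*$ with $\Psi(u)=\Psi(v)$, $u\in L$ iff $v\in L$. A subset of $\mathbb{N}^\Sigma$ is semilinear if it is a finite union of sets of the form $\{b+n_1p_1+\dots+n_rp_r : n_1,\dots,n_r\in\mathbb{N}\}$ with $b,p_1,\dots,p_r\in\mathbb{N}^\Sigma$. **Theorem.** If $L\subseteq\Sigma^*$ is permutation-invariant and definable in $\mathsf{LTL}[\mathsf{Count}]$, then its Parikh image $\Psi(L)=\{\Psi(w) : w\in L\}$ is semilinear. -/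

import Mathlib

namespace LTLCount

universe u

mutual

/-- Formulas of `LTL[Count]` over the alphabet `α`:
`φ ::= a | t ≤ t | ¬ φ | φ ∨ φ | X φ | φ U φ`. -/
inductive Formula (α : Type u)
  | letter (a : α) : Formula α
  | le (s t : Term α) : Formula α
  | neg (φ : Formula α) : Formula α
  | or (φ ψ : Formula α) : Formula α
  | next (φ : Formula α) : Formula α
  | untl (φ ψ : Formula α) : Formula α

/-- Counting terms of `LTL[Count]`, with integer coefficients:
`t ::= k | k · #←φ | k · #→φ | t + t`. -/
inductive Term (α : Type u)
  | const (k : ℤ) : Term α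
  | countLeft (k : ℤ) (φ : Formula α) : Term α
  | countRight (k : ℤ) (φ : Formula α) : Term α
  | add (s t : Term α) : Term α

end

mutual

/-- `Sat w φ i` says that the word `w` satisfies `φ` at position `i`. Positions are numbered from
`0`, so the positions of `w` are the `i < w.length`; the first position is `0`. -/
noncomputable def Sat {α : Type u} (w : List α) : Formula α → ℕ → Prop
  | .letter a, i => w[i]? = some a
  | .le s t, i => termVal w s i ≤ termVal w t i
  | .neg φ, i => ¬ Sat w φ i
  | .or φ ψ, i => Sat w φ i ∨ Sat w ψ i
  | .next φ, i => i + 1 < w.length ∧ Sat w φ (i + 1)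
  | .untl φ ψ, i =>
      ∃ j, i ≤ j ∧ j < w.length ∧ Sat w ψ j ∧ ∀ k, i ≤ k → k < j → Sat w φ k

/-- The value of a term in the word `w` at position `i`. The left count ranges over the positions
strictly before `i`, the right count over the positions from `i` on, `i` included. -/
noncomputable def termVal {α : Type u} (w : List α) : Term α → ℕ → ℤ
  | .const k, _ => k
  | .countLeft k φ, i => k * ({j : ℕ | j < i ∧ Sat w φ j}.ncard : ℤ)
  | .countRight k φ, i => k * ({j : ℕ | i ≤ j ∧ j < w.length ∧ Sat w φ j}.ncard : ℤ)
  | .add s t, i => termVal w s i + termVal w t i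

end

/-- A language is definable in `LTL[Count]` if some formula holds at the first position of exactly
those nonempty words that belong to the language. The empty word has no position, hence formulas
do not speak about it; a definable language may contain it or not. -/
def Definable {α : Type u} (L : Language α) : Prop :=
  ∃ φ : Formula α, ∀ w : List α, w ≠ [] → (w ∈ L ↔ Sat w φ 0)

/-- The Parikh map: the vector of the numbers of occurrences of each letter. -/
def parikh {α : Type u} [DecidableEq α] (w : List α) : α → ℕ := fun a => w.count a

/-- Membership in the language depends only on the Parikh vector. -/
def PermutationInvariant {α : Type u} [DecidableEq α] (L : Language α) : Prop :=
  ∀ u v : List α, parikh u = parikh v → (u ∈ L ↔ v ∈ L)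

/-- The Parikh image of a language. -/
def parikhImage {α : Type u} [DecidableEq α] (L : Language α) : Set (α → ℕ) :=
  {x | ∃ w ∈ L, parikh w = x}

end LTLCount

namespace LTLCount

universe u

/-! ### Semilinear predicates and functions -/

-- By permutation invariance, `L` may be tested on one representative per Parikh vector `n`: the
-- sorted word `blockWord l n`. On sorted words everything is Presburger: block boundaries are
-- partial sums of `n`, the temporal operators are quantifiers over positions, and semilinear
-- predicates are closed under Boolean operations and quantifiers. So satisfaction at `i` is
-- semilinear in `(n, i)` (`semilinearPred_sat`), provided counting terms stay inside the class.
--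
-- That is `SemilinearPred.semilinearCount`. A semilinear set is a finite union of linear sets with
-- independent periods; along the last coordinate these are convex modulo some `D`
-- (`exists_modConvex_of_isProperLinearSet`). Within one residue class such a section is an
-- arithmetic progression, whose size is definable from its endpoints. Inclusion–exclusion handles
-- unions.

/-- A predicate on a commutative monoid whose truth set is semilinear. -/
def SemilinearPred {M : Type*} [AddCommMonoid M] (P : M → Prop) : Prop :=
  IsSemilinearSet {x | P x}

/-- A natural-number valued function whose graph is semilinear. -/
def SemilinearFun {M : Type*} [AddCommMonoid M] (f : M → ℕ) : Prop :=
  SemilinearPred fun p : M × ℕ => p.2 = f p.1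

section Toolkit

variable {M N : Type*} [AddCommMonoid M] [AddCommMonoid N]

theorem SemilinearPred.congr {P Q : M → Prop} (hP : SemilinearPred P) (h : ∀ x, Q x ↔ P x) :
    SemilinearPred Q := by
  rwa [show Q = P from funext fun x => propext (h x)]

theorem SemilinearPred.and {P Q : M → Prop} (hP : SemilinearPred P) (hQ : SemilinearPred Q) :
    SemilinearPred fun x => P x ∧ Q x :=
  IsSemilinearSet.inter hP hQ

theorem SemilinearPred.or {P Q : M → Prop} (hP : SemilinearPred P) (hQ : SemilinearPred Q) :
    SemilinearPred fun x => P x ∨ Q x :=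
  IsSemilinearSet.union hP hQ

theorem SemilinearPred.exists {P : M → ℕ → Prop}
    (hP : SemilinearPred fun p : M × ℕ => P p.1 p.2) : SemilinearPred fun x => ∃ n, P x n := by
  have h := IsSemilinearSet.image hP (AddMonoidHom.fst M ℕ)
  refine (show SemilinearPred _ from h).congr fun x => ?_
  simp

variable [AddMonoid.FG M]

theorem SemilinearPred.not {P : M → Prop} (hP : SemilinearPred P) :
    SemilinearPred fun x => ¬ P x :=
  IsSemilinearSet.compl hP

theorem SemilinearPred.imp {P Q : M → Prop} (hP : SemilinearPred P) (hQ : SemilinearPred Q) :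
    SemilinearPred fun x => P x → Q x :=
  (hP.not.or hQ).congr fun _ => imp_iff_not_or

theorem SemilinearPred.forall {P : M → ℕ → Prop}
    (hP : SemilinearPred fun p : M × ℕ => P p.1 p.2) : SemilinearPred fun x => ∀ n, P x n :=
  (SemilinearPred.exists (P := fun x n => ¬ P x n) hP.not).not.congr fun x => by simp

theorem SemilinearPred.const (p : Prop) : SemilinearPred fun _ : M => p := by
  by_cases h : p
  · exact (show SemilinearPred fun _ : M => True from IsSemilinearSet.univ).congr fun _ => by
      simp [h]
  · exact (show SemilinearPred fun _ : M => False from IsSemilinearSet.empty).congr fun _ => by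
      simp [h]

theorem SemilinearPred.comp {P : N → Prop} (hP : SemilinearPred P) (g : M →+ N) :
    SemilinearPred fun x => P (g x) :=
  IsSemilinearSet.preimage hP g

theorem SemilinearFun.of_hom (g : M →+ ℕ) : SemilinearFun fun x => g x := by
  have := isSemilinearSet_setOfPred_eq 0 0 (AddMonoidHom.snd M ℕ) (g.comp (AddMonoidHom.fst M ℕ))
  exact (show SemilinearPred _ from this).congr fun x => by simp

theorem SemilinearFun.const (k : ℕ) : SemilinearFun fun _ : M => k := by
  have := isSemilinearSet_setOfPred_eq 0 k (AddMonoidHom.snd M ℕ) (0 : M × ℕ →+ ℕ)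
  exact (show SemilinearPred _ from this).congr fun x => by simp

theorem SemilinearFun.comp {f : N → ℕ} (hf : SemilinearFun f) (g : M →+ N) :
    SemilinearFun fun x => f (g x) :=
  SemilinearPred.comp hf (g.prodMap (AddMonoidHom.id ℕ))

/-- Substituting a homomorphism and a semilinear function into a semilinear predicate. -/
theorem SemilinearPred.subst {P : N → ℕ → Prop}
    (hP : SemilinearPred fun p : N × ℕ => P p.1 p.2) (g : M →+ N) {f : M → ℕ}
    (hf : SemilinearFun f) : SemilinearPred fun x => P (g x) (f x) :=
  (SemilinearPred.exists (P := fun x n => n = f x ∧ P (g x) n)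
    (hf.and (SemilinearPred.comp hP (g.prodMap (AddMonoidHom.id ℕ))))).congr fun x => by simp

theorem SemilinearPred.eq {f g : M → ℕ} (hf : SemilinearFun f) (hg : SemilinearFun g) :
    SemilinearPred fun x => f x = g x :=
  SemilinearPred.subst (P := fun x n => n = g x) hg (AddMonoidHom.id M) hf

theorem SemilinearFun.snd : SemilinearFun fun p : M × ℕ => p.2 :=
  SemilinearFun.of_hom (AddMonoidHom.snd M ℕ)

theorem SemilinearFun.weaken {f : M → ℕ} (hf : SemilinearFun f) :
    SemilinearFun fun p : M × ℕ => f p.1 :=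
  hf.comp (AddMonoidHom.fst M ℕ)

theorem SemilinearFun.add {f g : M → ℕ} (hf : SemilinearFun f) (hg : SemilinearFun g) :
    SemilinearFun fun x => f x + g x := by
  have h0 : SemilinearPred fun q : ((M × ℕ) × ℕ) × ℕ => q.1.1.2 = q.1.2 + q.2 :=
    (SemilinearPred.eq SemilinearFun.snd.weaken.weaken
      (SemilinearFun.of_hom (((AddMonoidHom.snd (M × ℕ) ℕ).comp (AddMonoidHom.fst _ ℕ)) +
        AddMonoidHom.snd ((M × ℕ) × ℕ) ℕ)))
  have h1 : SemilinearPred fun q : (M × ℕ) × ℕ => q.1.2 = q.2 + g q.1.1 :=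
    SemilinearPred.subst (P := fun (q : (M × ℕ) × ℕ) n => q.1.2 = q.2 + n) h0 (AddMonoidHom.id _)
      hg.weaken.weaken
  exact SemilinearPred.subst (P := fun (q : M × ℕ) n => q.2 = n + g q.1) h1 (AddMonoidHom.id _)
    hf.weaken

/-- A function is semilinear if its sum with a semilinear function is semilinear. -/
theorem SemilinearFun.of_add_eq {f g h : M → ℕ} (hg : SemilinearFun g) (hh : SemilinearFun h)
    (e : ∀ x, f x + g x = h x) : SemilinearFun f :=
  (SemilinearPred.eq (SemilinearFun.snd.add hg.weaken) hh.weaken).congr fun p => by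
    have := e p.1
    omega

theorem SemilinearFun.const_mul (k : ℕ) {f : M → ℕ} (hf : SemilinearFun f) :
    SemilinearFun fun x => k * f x := by
  induction k with
  | zero => simpa using SemilinearFun.const 0
  | succ k ih => simpa [Nat.succ_mul] using ih.add hf

theorem SemilinearFun.finset_sum {ι : Type*} (s : Finset ι) {f : ι → M → ℕ}
    (hf : ∀ i ∈ s, SemilinearFun (f i)) : SemilinearFun fun x => ∑ i ∈ s, f i x := by
  classical
  induction s using Finset.induction_on with
  | empty => simpa using SemilinearFun.const 0
  | insert a s ha ih =>
    simp only [Finset.sum_insert ha]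
    exact (hf a (by simp)).add (ih fun i hi => hf i (by simp [hi]))

theorem SemilinearPred.le {f g : M → ℕ} (hf : SemilinearFun f) (hg : SemilinearFun g) :
    SemilinearPred fun x => f x ≤ g x :=
  (SemilinearPred.exists (P := fun x n => g x = f x + n)
    (SemilinearPred.eq hg.weaken (hf.weaken.add SemilinearFun.snd))).congr fun _ =>
      le_iff_exists_add

theorem SemilinearPred.lt {f g : M → ℕ} (hf : SemilinearFun f) (hg : SemilinearFun g) :
    SemilinearPred fun x => f x < g x :=
  SemilinearPred.le (hf.add (SemilinearFun.const 1)) hg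

theorem SemilinearPred.mod_eq (D r : ℕ) {f : M → ℕ} (hf : SemilinearFun f) :
    SemilinearPred fun x => f x % D = r := by
  have h := (SemilinearPred.exists (P := fun x n => f x = r + D * n)
    (SemilinearPred.eq hf.weaken
      ((SemilinearFun.const r).add (SemilinearFun.snd.const_mul D)))).and
    (SemilinearPred.const (r < D ∨ D = 0))
  refine h.congr fun x => ⟨fun e => ⟨⟨f x / D, ?_⟩, ?_⟩, ?_⟩
  · rw [← e, Nat.mod_add_div]
  · rcases Nat.eq_zero_or_pos D with h | h
    · exact .inr h
    · exact .inl (e ▸ Nat.mod_lt _ h)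
  · rintro ⟨⟨n, e⟩, h⟩
    rcases h with h | rfl
    · rw [e, Nat.add_mul_mod_self_left, Nat.mod_eq_of_lt h]
    · simpa using e

end Toolkit

/-! ### Convexity of proper linear sets along the last coordinate -/

/-- The sections of `P` along the last coordinate are convex within each residue class mod `D`. -/
def ModConvex {M : Type*} (D : ℕ) (P : M → ℕ → Prop) : Prop :=
  ∀ x y j k, P x y → P x (y + D * k) → j ≤ k → P x (y + D * j)

theorem ModConvex.of_dvd {M : Type*} {D E : ℕ} {P : M → ℕ → Prop} (h : ModConvex D P)
    (hd : D ∣ E) : ModConvex E P := by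
  obtain ⟨c, rfl⟩ := hd
  intro x y j k h1 h2 h3
  rw [mul_assoc] at *
  exact h x y _ _ h1 h2 (Nat.mul_le_mul_left c h3)

theorem ModConvex.and {M : Type*} {D : ℕ} {P Q : M → ℕ → Prop} (hP : ModConvex D P)
    (hQ : ModConvex D Q) : ModConvex D fun x y => P x y ∧ Q x y :=
  fun x y j k h1 h2 h3 => ⟨hP x y j k h1.1 h2.1 h3, hQ x y j k h1.2 h2.2 h3⟩

open scoped Pointwise in
-- Independent periods give unique coefficients. If two period combinations differ by `(0, D)`,
-- moving up by `D` always shifts the coefficients by the same integer vector, and nonnegativity at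
-- both ends of a segment gives it in between.
theorem exists_modConvex_of_isProperLinearSet {M : Type*} [AddCommMonoid M] [IsCancelAdd M]
    {s : Set (M × ℕ)} (hs : IsProperLinearSet s) :
    ∃ D > 0, ModConvex D fun x y => (x, y) ∈ s := by
  obtain ⟨b, t, ht, hli, rfl⟩ := hs
  have := ht.fintype
  set S : (t → ℕ) → M × ℕ := fun c => ∑ i, c i • (i : M × ℕ) with hS
  have hadd : ∀ c d, S (c + d) = S c + S d := fun c d => by
    simp [hS, add_smul, Finset.sum_add_distrib]
  have hmul : ∀ (k : ℕ) c, S (k • c) = k • S c := fun k c => by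
    simp [hS, mul_smul, Finset.smul_sum]
  have hinj : ∀ c d, S c = S d → c = d := by
    intro c d h
    exact (Fintype.linearIndependent_iffₛ.1 hli c d h) |> funext
  have hmem : ∀ z, z ∈ b +ᵥ (AddSubmonoid.closure t : Set (M × ℕ)) ↔ ∃ c, z = b + S c := by
    intro z
    simp only [Set.mem_vadd_set, SetLike.mem_coe, AddSubmonoid.mem_closure_iff_of_fintype,
      vadd_eq_add]
    constructor
    · rintro ⟨_, ⟨c, rfl⟩, rfl⟩
      exact ⟨c, rfl⟩
    · rintro ⟨c, rfl⟩
      exact ⟨_, ⟨c, rfl⟩, rfl⟩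
  by_cases hex : ∃ D > 0, ∃ c d, S d = S c + (0, D)
  · obtain ⟨D, hD, c, d, hcd⟩ := hex
    refine ⟨D, hD, fun x y j k h1 h2 hjk => ?_⟩
    obtain ⟨e, he⟩ := (hmem _).1 h1
    obtain ⟨f, hf⟩ := (hmem _).1 h2
    have hef : S f = S e + k • (0, D) := by
      apply add_left_cancel (a := b)
      rw [← hf, ← add_assoc, ← he]
      simp [mul_comm]
    have key : f + k • c = e + k • d := by
      apply hinj
      rw [hadd, hadd, hmul, hmul, hcd, hef, smul_add]
      abel
    -- `e i + j * (d i - c i)` is affine in `j`, equal to `e i ≥ 0` at `0` and, by `key`, to `f i ≥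
    -- 0` at `k`.
    have hge : ∀ i, j * c i ≤ e i + j * d i := by
      intro i
      have hi : f i + k * c i = e i + k * d i := congrFun key i
      rcases le_total (c i) (d i) with h | h
      · exact (Nat.mul_le_mul_left j h).trans (Nat.le_add_left _ _)
      · obtain ⟨u, hu⟩ := Nat.exists_eq_add_of_le h
        have : k * u ≤ e i := by rw [hu] at hi; nlinarith
        have : j * u ≤ e i := (Nat.mul_le_mul_right u hjk).trans this
        rw [hu]; nlinarith
    refine (hmem _).2 ⟨fun i => e i + j * d i - j * c i, ?_⟩
    have h3 : (fun i => e i + j * d i - j * c i) + j • c = e + j • d := by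
      ext i
      simpa using Nat.sub_add_cancel (hge i)
    have h4 := congrArg S h3
    rw [hadd, hadd, hmul, hmul, hcd, smul_add] at h4
    have h5 : S (fun i => e i + j * d i - j * c i) = S e + j • (0, D) := by
      apply add_right_cancel (b := j • S c)
      rw [h4]; abel
    rw [h5, ← add_assoc, ← he]
    simp [mul_comm]
  -- Here each section has at most one point, so any modulus would do.
  · refine ⟨1, one_pos, fun x y j k h1 h2 hjk => ?_⟩
    obtain ⟨e, he⟩ := (hmem _).1 h1
    obtain ⟨f, hf⟩ := (hmem _).1 h2
    have hk : k = 0 := by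
      by_contra hk
      refine hex ⟨k, Nat.pos_of_ne_zero hk, e, f, ?_⟩
      apply add_left_cancel (a := b)
      rw [← hf, ← add_assoc, ← he]
      simp
    have hj : j = 0 := by omega
    simpa [hj] using h1

/-! ### Counting in sections of semilinear predicates -/

theorem ncard_eq_of_modConvex {D n a k : ℕ} (hD : 0 < D) {Q : ℕ → Prop}
    (hc : ∀ y j k, Q y → Q (y + D * k) → j ≤ k → Q (y + D * j))
    (hr : ∀ y z, Q y → Q z → y % D = z % D) (ha : Q a) (hn : a + D * k < n)
    (hb : Q (a + D * k)) (hab : ∀ y, y < n → Q y → a ≤ y ∧ y ≤ a + D * k) :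
    {y | y < n ∧ Q y}.ncard = k + 1 := by
  have h : {y | y < n ∧ Q y} = (fun j => a + D * j) '' (Finset.range (k + 1) : Set ℕ) := by
    ext y
    simp only [Set.mem_ofPred_eq, Set.mem_image, Finset.coe_range, Set.mem_Iio]
    constructor
    · rintro ⟨hy, hQ⟩
      obtain ⟨h1, h2⟩ := hab y hy hQ
      obtain ⟨j, hj⟩ := (Nat.modEq_iff_dvd' h1).1 (hr a y ha hQ)
      refine ⟨j, ?_, by omega⟩
      have : D * j ≤ D * k := by omega
      exact Nat.lt_succ_of_le (Nat.le_of_mul_le_mul_left this hD)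
    · rintro ⟨j, hj, rfl⟩
      have hj' : D * j ≤ D * k := Nat.mul_le_mul_left D (Nat.le_of_lt_succ hj)
      exact ⟨by omega, hc a j k ha hb (Nat.le_of_lt_succ hj)⟩
  rw [h, Set.ncard_image_of_injective, Set.ncard_coe_finset, Finset.card_range]
  intro i j hij
  exact Nat.eq_of_mul_eq_mul_left hD (by simpa using hij)

theorem exists_endpoints_of_mod_eq {D n : ℕ} {Q : ℕ → Prop}
    (hr : ∀ y z, Q y → Q z → y % D = z % D) (hne : ∃ y, y < n ∧ Q y) :
    ∃ a k, Q a ∧ a + D * k < n ∧ Q (a + D * k) ∧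
      ∀ y, y < n → Q y → a ≤ y ∧ y ≤ a + D * k := by
  have hfin : {y | y < n ∧ Q y}.Finite := (Set.finite_lt_nat n).subset fun y hy => hy.1
  obtain ⟨a, ha, ha'⟩ := Set.exists_min_image _ id hfin hne
  obtain ⟨b, hb, hb'⟩ := Set.exists_max_image _ id hfin hne
  obtain ⟨k, hk⟩ := (Nat.modEq_iff_dvd' (ha' b hb)).1 (hr a b ha.2 hb.2)
  have hab : a ≤ b := ha' b hb
  have hk' : a + D * k = b := by simp only [id] at hk; omega
  refine ⟨a, k, ha.2, hk' ▸ hb.1, hk' ▸ hb.2, fun y hy hQ => ⟨ha' y ⟨hy, hQ⟩, ?_⟩⟩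
  rw [hk']
  exact hb' y ⟨hy, hQ⟩

/-- The number of `y < n` with `P x y` is a semilinear function of `(x, n)`. -/
def SemilinearCount {M : Type*} [AddCommMonoid M] (P : M → ℕ → Prop) : Prop :=
  SemilinearFun fun p : M × ℕ => {y | y < p.2 ∧ P p.1 y}.ncard

section Counting

variable {M : Type*} [AddCommMonoid M] [AddMonoid.FG M]

/-- The count is first-order definable: it is `0` for an empty section, and `k + 1` when the least
and greatest elements are `a` and `a + D * k`, since convexity fills the progression. -/
theorem SemilinearCount.of_mod_eq {D : ℕ} (hD : 0 < D) {P : M → ℕ → Prop}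
    (hP : SemilinearPred fun p : M × ℕ => P p.1 p.2) (hc : ModConvex D P)
    (hr : ∀ x y z, P x y → P x z → y % D = z % D) : SemilinearCount P := by
  let fM : (M × ℕ) × ℕ →+ M := (AddMonoidHom.fst M ℕ).comp (AddMonoidHom.fst (M × ℕ) ℕ)
  have h0 : SemilinearPred fun q : (M × ℕ) × ℕ => q.2 = 0 ∧ ¬ ∃ y, y < q.1.2 ∧ P q.1.1 y := by
    refine (SemilinearPred.eq SemilinearFun.snd (SemilinearFun.const 0)).and
      (SemilinearPred.not (SemilinearPred.exists (SemilinearPred.and ?_ ?_)))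
    · exact SemilinearPred.lt SemilinearFun.snd SemilinearFun.snd.weaken.weaken
    · exact hP.subst (fM.comp (AddMonoidHom.fst _ ℕ)) SemilinearFun.snd
  let gM : (((M × ℕ) × ℕ) × ℕ) × ℕ →+ M :=
    fM.comp ((AddMonoidHom.fst _ ℕ).comp (AddMonoidHom.fst _ ℕ))
  have hend : SemilinearFun fun q : (((M × ℕ) × ℕ) × ℕ) × ℕ => q.1.2 + D * q.2 :=
    SemilinearFun.snd.weaken.add (SemilinearFun.snd.const_mul D)
  have hnn : SemilinearFun fun q : (((M × ℕ) × ℕ) × ℕ) × ℕ => q.1.1.1.2 :=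
    SemilinearFun.snd.weaken.weaken.weaken
  have h1 : SemilinearPred fun q : (M × ℕ) × ℕ => ∃ a k, (P q.1.1 a ∧ a + D * k < q.1.2 ∧
      P q.1.1 (a + D * k) ∧ ∀ y, y < q.1.2 → P q.1.1 y → a ≤ y ∧ y ≤ a + D * k) ∧
      q.2 = k + 1 := by
    refine SemilinearPred.exists (SemilinearPred.exists (((hP.subst gM ?_).and
      ((SemilinearPred.lt hend hnn).and ((hP.subst gM hend).and
        (SemilinearPred.forall (SemilinearPred.imp ?_ (SemilinearPred.imp ?_ (.and ?_ ?_))))))).and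
      ?_))
    · exact SemilinearFun.snd.weaken
    · exact SemilinearPred.lt SemilinearFun.snd hnn.weaken
    · exact hP.subst (gM.comp (AddMonoidHom.fst _ ℕ)) SemilinearFun.snd
    · exact SemilinearPred.le SemilinearFun.snd.weaken.weaken SemilinearFun.snd
    · exact SemilinearPred.le SemilinearFun.snd hend.weaken
    · exact SemilinearPred.eq SemilinearFun.snd.weaken.weaken
        (SemilinearFun.snd.add (SemilinearFun.const 1))
  refine (h0.or h1).congr ?_
  rintro ⟨⟨x, n⟩, z⟩
  have hcard : ∀ a k, (P x a ∧ a + D * k < n ∧ P x (a + D * k) ∧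
      ∀ y, y < n → P x y → a ≤ y ∧ y ≤ a + D * k) → {y | y < n ∧ P x y}.ncard = k + 1 :=
    fun a k h => ncard_eq_of_modConvex hD (hc x) (hr x) h.1 h.2.1 h.2.2.1 h.2.2.2
  simp only
  constructor
  · rintro rfl
    by_cases hne : ∃ y, y < n ∧ P x y
    · obtain ⟨a, k, h⟩ := exists_endpoints_of_mod_eq (hr x) hne
      exact .inr ⟨a, k, h, hcard a k h⟩
    · refine .inl ⟨?_, hne⟩
      rw [show {y | y < n ∧ P x y} = ∅ from Set.eq_empty_of_forall_notMem fun y hy => hne ⟨y, hy⟩]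
      exact Set.ncard_empty ℕ
  · rintro (⟨rfl, hne⟩ | ⟨a, k, h, rfl⟩)
    · rw [show {y | y < n ∧ P x y} = ∅ from Set.eq_empty_of_forall_notMem fun y hy => hne ⟨y, hy⟩]
      exact (Set.ncard_empty ℕ).symm
    · exact (hcard a k h).symm

theorem ncard_eq_sum_mod {D : ℕ} (hD : 0 < D) (n : ℕ) (Q : ℕ → Prop) :
    {y | y < n ∧ Q y}.ncard =
      ∑ r ∈ Finset.range D, {y | y < n ∧ (Q y ∧ y % D = r)}.ncard := by
  classical
  have h : ∀ R : ℕ → Prop, {y | y < n ∧ R y}.ncard = ((Finset.range n).filter R).card := by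
    intro R
    rw [← Set.ncard_coe_finset]
    congr 1
    ext y
    simp
  simp only [h]
  rw [Finset.card_eq_sum_card_fiberwise (f := (· % D)) (t := Finset.range D)]
  · refine Finset.sum_congr rfl fun r _ => ?_
    rw [Finset.filter_filter]
    congr!
  · intro y _
    simpa using Nat.mod_lt y hD

theorem SemilinearCount.of_modConvex {D : ℕ} (hD : 0 < D) {P : M → ℕ → Prop}
    (hP : SemilinearPred fun p : M × ℕ => P p.1 p.2) (hc : ModConvex D P) :
    SemilinearCount P := by
  unfold SemilinearCount
  simp only [fun p : M × ℕ => ncard_eq_sum_mod hD p.2 (P p.1)]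
  refine SemilinearFun.finset_sum _ fun r _ => ?_
  refine SemilinearCount.of_mod_eq (P := fun x y => P x y ∧ y % D = r) hD
    (hP.and (SemilinearPred.mod_eq D r SemilinearFun.snd)) (hc.and ?_) ?_
  · intro x y j k h1 h2 h3
    simpa using h1
  · rintro x y z ⟨_, rfl⟩ ⟨_, h⟩
    exact h.symm

theorem SemilinearCount.or {P Q : M → ℕ → Prop} (hP : SemilinearCount P)
    (hQ : SemilinearCount Q) (hPQ : SemilinearCount fun x y => P x y ∧ Q x y) :
    SemilinearCount fun x y => P x y ∨ Q x y := by
  refine SemilinearFun.of_add_eq hPQ (SemilinearFun.add hP hQ) fun p => ?_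
  have hfin : ∀ R : ℕ → Prop, {y | y < p.2 ∧ R y}.Finite := fun R =>
    (Set.finite_lt_nat p.2).subset fun y hy => hy.1
  rw [← Set.ncard_union_add_ncard_inter _ _ (hfin (P p.1)) (hfin (Q p.1))]
  congr 2 <;> ext y <;> simp <;> tauto

theorem SemilinearCount.exists_mem_list {D : ℕ} (hD : 0 < D) (l : List (M → ℕ → Prop))
    (hl : ∀ P ∈ l, SemilinearPred (fun p : M × ℕ => P p.1 p.2) ∧ ModConvex D P) :
    SemilinearCount fun x y => ∃ P ∈ l, P x y := by
  -- Induction on the length, because inclusion–exclusion also needs the claim for the tail with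
  -- each member intersected with `T`.
  induction hm : l.length generalizing l with
  | zero =>
    obtain rfl := List.length_eq_zero_iff.1 hm
    unfold SemilinearCount
    simpa using SemilinearFun.const 0
  | succ m ih =>
    obtain ⟨T, l, rfl⟩ := List.exists_cons_of_length_eq_add_one hm
    have hT := hl T (by simp)
    have hl' : ∀ P ∈ l, _ := fun P hP => hl P (List.mem_cons_of_mem T hP)
    have h := SemilinearCount.or (SemilinearCount.of_modConvex hD hT.1 hT.2)
      (ih l hl' (by simpa using hm)) ?_
    · simpa using h
    · have := ih (l.map fun P x y => T x y ∧ P x y) ?_ (by simpa using hm)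
      · simpa [and_left_comm] using this
      · simp only [List.mem_map]
        rintro _ ⟨P, hP, rfl⟩
        exact ⟨hT.1.and (hl' P hP).1, hT.2.and (hl' P hP).2⟩

/-- Presburger arithmetic admits unary counting: the number of `y < n` satisfying a semilinear
predicate is a semilinear function. -/
theorem SemilinearPred.semilinearCount [IsCancelAdd M] {P : M → ℕ → Prop}
    (hP : SemilinearPred fun p : M × ℕ => P p.1 p.2) : SemilinearCount P := by
  obtain ⟨S, hS, hU⟩ := isProperSemilinearSet_iff.1 (IsSemilinearSet.isProperSemilinearSet hP)
  choose! D hD hDc using fun s (hs : s ∈ S) => exists_modConvex_of_isProperLinearSet (hS s hs)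
  -- The product is a common modulus for all the pieces, so their intersections are convex modulo it
  -- too.
  have h := SemilinearCount.exists_mem_list (D := ∏ s ∈ S, D s) (Finset.prod_pos hD)
    (S.toList.map fun s x y => (x, y) ∈ s) ?_
  · convert h using 3 with x y
    have : (x, y) ∈ {p : M × ℕ | P p.1 p.2} ↔ ∃ s ∈ S, (x, y) ∈ s := by
      rw [hU]; simp
    simpa using this
  · simp only [List.mem_map, Finset.mem_toList]
    rintro _ ⟨s, hs, rfl⟩
    exact ⟨(hS s hs).isLinearSet.isSemilinearSet, (hDc s hs).of_dvd (Finset.dvd_prod_of_mem D hs)⟩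

end Counting

/-! ### Formulas on sorted words -/

/-- The word consisting of `n a` copies of each letter `a` of `l`, in the order of `l`. -/
def blockWord {α : Type u} (l : List α) (n : α → ℕ) : List α :=
  l.flatMap fun a => List.replicate (n a) a

section Words

variable {α : Type u}

theorem parikh_blockWord [DecidableEq α] {l : List α} (hl : l.Nodup) (hmem : ∀ a, a ∈ l)
    (n : α → ℕ) : parikh (blockWord l n) = n := by
  have h : ∀ l : List α, l.Nodup → ∀ a, (blockWord l n).count a = if a ∈ l then n a else 0 := by
    intro l hl a
    induction l with
    | nil => simp [blockWord]
    | cons b l ih =>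
      have hb : b ∉ l := (List.nodup_cons.1 hl).1
      have e : blockWord (b :: l) n = List.replicate (n b) b ++ blockWord l n := by
        simp [blockWord]
      rw [e, List.count_append, ih (List.nodup_cons.1 hl).2, List.count_replicate]
      by_cases hab : b = a
      · subst hab
        simp [hb]
      · simp [hab, Ne.symm hab]
  funext a
  simp [parikh, h l hl, hmem]

variable [Finite α]

theorem semilinearFun_length_blockWord (l : List α) :
    SemilinearFun fun n : α → ℕ => (blockWord l n).length := by
  induction l with
  | nil => simpa [blockWord] using SemilinearFun.const 0
  | cons a l ih =>
    have := (SemilinearFun.of_hom (Pi.evalAddMonoidHom (fun _ : α => ℕ) a)).add ih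
    simpa [blockWord] using this

theorem semilinearPred_getElem?_blockWord (l : List α) (b : α) :
    SemilinearPred fun p : (α → ℕ) × ℕ => (blockWord l p.1)[p.2]? = some b := by
  induction l with
  | nil => simpa [blockWord] using SemilinearPred.const False
  | cons a l ih =>
    have ha : SemilinearFun fun n : α → ℕ => n a :=
      SemilinearFun.of_hom (Pi.evalAddMonoidHom (fun _ : α => ℕ) a)
    have h := ((SemilinearPred.lt SemilinearFun.snd ha.weaken).and
      (SemilinearPred.const (a = b))).or (SemilinearPred.exists
        (P := fun (p : (α → ℕ) × ℕ) j => p.2 = p.1 a + j ∧ (blockWord l p.1)[j]? = some b)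
        ((SemilinearPred.eq SemilinearFun.snd.weaken (ha.weaken.weaken.add SemilinearFun.snd)).and
          (SemilinearPred.subst (P := fun n j => (blockWord l n)[j]? = some b) ih
            ((AddMonoidHom.fst _ ℕ).comp (AddMonoidHom.fst _ ℕ)) SemilinearFun.snd)))
    refine h.congr ?_
    rintro ⟨n, i⟩
    have e : blockWord (a :: l) n = List.replicate (n a) a ++ blockWord l n := by
      simp [blockWord]
    simp only [e, List.getElem?_append, List.length_replicate, List.getElem?_replicate]
    split_ifs with hi
    · simp only [Option.some.injEq]
      constructor
      · exact fun h => .inl ⟨hi, h⟩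
      · rintro (h | ⟨j, hj, _⟩)
        · exact h.2
        · omega
    · constructor
      · exact fun h => .inr ⟨i - n a, by omega, h⟩
      · rintro (h | ⟨j, rfl, h⟩)
        · exact absurd h.1 hi
        · simpa using h

mutual

theorem semilinearPred_sat (l : List α) : ∀ φ : Formula α,
    SemilinearPred fun p : (α → ℕ) × ℕ => Sat (blockWord l p.1) φ p.2
  | .letter a => by
    simpa only [Sat] using semilinearPred_getElem?_blockWord l a
  | .le s t => by
    obtain ⟨f, g, hf, hg, h⟩ := exists_semilinearFun_termVal l s
    obtain ⟨f', g', hf', hg', h'⟩ := exists_semilinearFun_termVal l t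
    refine (SemilinearPred.le (hf.add hg') (hf'.add hg)).congr fun p => ?_
    rw [Sat, h, h']
    omega
  | .neg φ => by
    simpa only [Sat] using (semilinearPred_sat l φ).not
  | .or φ ψ => by
    simpa only [Sat] using (semilinearPred_sat l φ).or (semilinearPred_sat l ψ)
  | .next φ => by
    simp only [Sat]
    exact (SemilinearPred.lt (SemilinearFun.snd.add (SemilinearFun.const 1))
      (semilinearFun_length_blockWord l).weaken).and
      (SemilinearPred.subst (P := fun n i => Sat (blockWord l n) φ i) (semilinearPred_sat l φ)
        (AddMonoidHom.fst _ ℕ) (SemilinearFun.snd.add (SemilinearFun.const 1)))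
  | .untl φ ψ => by
    simp only [Sat]
    refine SemilinearPred.exists ((SemilinearPred.le SemilinearFun.snd.weaken
      SemilinearFun.snd).and ((SemilinearPred.lt SemilinearFun.snd
        (semilinearFun_length_blockWord l).weaken.weaken).and (SemilinearPred.and
        (SemilinearPred.subst (P := fun n i => Sat (blockWord l n) ψ i) (semilinearPred_sat l ψ)
          ((AddMonoidHom.fst _ ℕ).comp (AddMonoidHom.fst _ ℕ)) SemilinearFun.snd)
        (SemilinearPred.forall (SemilinearPred.imp
          (SemilinearPred.le SemilinearFun.snd.weaken.weaken SemilinearFun.snd)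
          (SemilinearPred.imp (SemilinearPred.lt SemilinearFun.snd SemilinearFun.snd.weaken)
            (SemilinearPred.subst (P := fun n i => Sat (blockWord l n) φ i)
              (semilinearPred_sat l φ)
              ((AddMonoidHom.fst _ ℕ).comp ((AddMonoidHom.fst _ ℕ).comp (AddMonoidHom.fst _ ℕ)))
              SemilinearFun.snd)))))))

/-- Terms take integer values but semilinear functions are natural-valued, hence a difference of
two; comparisons of terms are then cross-added. -/
theorem exists_semilinearFun_termVal (l : List α) : ∀ t : Term α,
    ∃ f g : (α → ℕ) × ℕ → ℕ, SemilinearFun f ∧ SemilinearFun g ∧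
      ∀ p, termVal (blockWord l p.1) t p.2 = (f p : ℤ) - g p
  | .const k => ⟨fun _ => k.toNat, fun _ => (-k).toNat, SemilinearFun.const _,
      SemilinearFun.const _, fun p => by rw [termVal]; exact (Int.toNat_sub_toNat_neg k).symm⟩
  | .countLeft k φ => by
    have hc : SemilinearFun fun p : (α → ℕ) × ℕ =>
        {j : ℕ | j < p.2 ∧ Sat (blockWord l p.1) φ j}.ncard :=
      (semilinearPred_sat l φ).semilinearCount (P := fun n i => Sat (blockWord l n) φ i)
    refine ⟨_, _, hc.const_mul k.toNat, hc.const_mul (-k).toNat, fun p => ?_⟩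
    rw [termVal]
    push_cast
    rw [← sub_mul, Int.toNat_sub_toNat_neg]
  | .countRight k φ => by
    have h := SemilinearPred.semilinearCount
      (P := fun (p : (α → ℕ) × ℕ) j => p.2 ≤ j ∧ Sat (blockWord l p.1) φ j)
      ((SemilinearPred.le SemilinearFun.snd.weaken SemilinearFun.snd).and
        (SemilinearPred.subst (P := fun n i => Sat (blockWord l n) φ i) (semilinearPred_sat l φ)
          ((AddMonoidHom.fst _ ℕ).comp (AddMonoidHom.fst _ ℕ)) SemilinearFun.snd))
    have hc : SemilinearFun fun p : (α → ℕ) × ℕ =>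
        {j : ℕ | p.2 ≤ j ∧ j < (blockWord l p.1).length ∧ Sat (blockWord l p.1) φ j}.ncard := by
      -- The position is a parameter of the count, leaving its upper bound `m` free to be replaced
      -- by the word length.
      have h' := SemilinearPred.subst (M := ((α → ℕ) × ℕ) × ℕ)
        (P := fun (q : ((α → ℕ) × ℕ) × ℕ) m =>
          q.2 = {j : ℕ | j < m ∧ (q.1.2 ≤ j ∧ Sat (blockWord l q.1.1) φ j)}.ncard)
        (f := fun q => (blockWord l q.1.1).length)
        (SemilinearPred.eq SemilinearFun.snd.weaken (SemilinearFun.comp h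
          (((AddMonoidHom.fst _ ℕ).comp (AddMonoidHom.fst _ ℕ)).prod (AddMonoidHom.snd _ ℕ))))
        (AddMonoidHom.id _) (semilinearFun_length_blockWord l).weaken.weaken
      refine h'.congr fun q => ?_
      simp only [AddMonoidHom.id_apply, and_left_comm]
    refine ⟨_, _, hc.const_mul k.toNat, hc.const_mul (-k).toNat, fun p => ?_⟩
    rw [termVal]
    push_cast
    rw [← sub_mul, Int.toNat_sub_toNat_neg]
  | .add s t => by
    obtain ⟨f, g, hf, hg, h⟩ := exists_semilinearFun_termVal l s
    obtain ⟨f', g', hf', hg', h'⟩ := exists_semilinearFun_termVal l t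
    refine ⟨_, _, hf.add hf', hg.add hg', fun p => ?_⟩
    rw [termVal, h, h']
    push_cast
    ring

end

end Words

end LTLCount

theorem mainTheorem9 {α : Type*} [Finite α] [DecidableEq α] (L : Language α)
    (hdef : LTLCount.Definable L) (hperm : LTLCount.PermutationInvariant L) :
    IsSemilinearSet (LTLCount.parikhImage L) := by
  open LTLCount in
  have := Fintype.ofFinite α
  obtain ⟨φ, hφ⟩ := hdef
  set l : List α := Finset.univ.toList with hl
  have hpar : ∀ n, parikh (blockWord l n) = n :=
    parikh_blockWord (Finset.nodup_toList _) fun a => by simp [hl]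
  have himage : ∀ n, n ∈ parikhImage L ↔ blockWord l n ∈ L := fun n =>
    ⟨fun ⟨w, hw, e⟩ => (hperm _ _ (e.trans (hpar n).symm)).1 hw, fun h => ⟨_, h, hpar n⟩⟩
  have hsat : SemilinearPred fun n : α → ℕ => Sat (blockWord l n) φ 0 :=
    SemilinearPred.subst (P := fun n i => Sat (blockWord l n) φ i) (semilinearPred_sat l φ)
      (AddMonoidHom.id _) (SemilinearFun.const 0)
  -- Definability says nothing about the empty word, so length `0` is split off and decided by the
  -- constant `[] ∈ L`.
  have hlen := SemilinearPred.eq (semilinearFun_length_blockWord l) (SemilinearFun.const 0)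
  refine (show SemilinearPred (· ∈ parikhImage L) from ?_)
  refine ((hlen.and (SemilinearPred.const ([] ∈ L))).or (hlen.not.and hsat)).congr fun n => ?_
  rw [himage]
  by_cases h : blockWord l n = []
  · simp [h]
  · simp [h, hφ _ h]
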